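/- Let $\mathbb{P}^n=\mathbb{P}^n_{\mathbb{C}}$ and let $Z\subset\mathbb{P}^n$ be a finite set of $\ell(Z)$ points. The Kruskal rank of a finite set $A\subset\mathbb{P}^n$ is the largest $k\le\ell(A)$ such that every subset of $A$ consisting of $k$ points is linearly independent; $A$ is in linear general position (LGP) if its Kruskal rank equals $\min\{\ell(A),n+1\}$. For $j\ge 0$, $h_Z(j)$ denotes the rank of the linear map that evaluates the forms of degree $j$ in $n+1$ variables over $\mathbb{C}$ at a set of representatives in $\mathbb{C}^{n+1}$ of the points of $Z$ (it does not depend on the representatives). A rational normal curve in $\mathbb{P}^n$ is the image of $\mathbb{P}^1$ under the Veronese map $[s:t]\mapsto[s^n:s^{n-1}t:\dots:t^n]$, up to a linear change of coordinates in $\mathbb{P}^n$. Assume that (i) $\ell(Z)\ge 2n+3$; (ii) $h_Z(2)\le 2n+1$; (iii) there exists $A\subset Z$ such that $\ell(A)=2n+1$ and $A$ is in LGP. Then $Z$ is in LGP and $Z$ is contained in a rational normal curve. -/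

import Mathlib

open scoped LinearAlgebra.Projectivization

noncomputable section

/-- The complex projective space `ℙⁿ`, as the projectivization of `ℂⁿ⁺¹`. -/
abbrev PSpace (n : ℕ) : Type := ℙ ℂ (Fin (n + 1) → ℂ)

/-- The Kruskal rank of a finite set `A ⊂ ℙⁿ`: the largest `k` (with `k ≤ ℓ(A)`, so that there are
subsets of `k` points) such that all subsets of `k` points of `A` are linearly independent. -/
def kruskalRank {n : ℕ} (A : Finset (PSpace n)) : ℕ :=
  sSup {k : ℕ | k ≤ A.card ∧
    ∀ B ⊆ A, B.card = k → Projectivization.Independent (fun P : B => (P : PSpace n))}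

/-- Linear general position: the Kruskal rank is the maximal possible, `min {ℓ(A), n + 1}`. -/
def IsLGP {n : ℕ} (A : Finset (PSpace n)) : Prop :=
  kruskalRank A = min A.card (n + 1)

/-- The evaluation map in degree `j` on a family of vectors of `ℂⁿ⁺¹`, sending a form `F` of
degree `j` in `n + 1` variables to its values at the vectors of the family. -/
def evalMap {n : ℕ} {ι : Type*} (Y : ι → Fin (n + 1) → ℂ) (j : ℕ) :
    MvPolynomial.homogeneousSubmodule (Fin (n + 1)) ℂ j →ₗ[ℂ] (ι → ℂ) where
  toFun F i := MvPolynomial.eval (Y i) (F : MvPolynomial (Fin (n + 1)) ℂ)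
  map_add' F G := by ext i; simp
  map_smul' c F := by ext i; simp

/-- The Hilbert function of a finite set `Z ⊂ ℙⁿ`: the rank of the evaluation map of degree `j` on
a choice of representatives of the points of `Z` if `j ≥ 0`, and `0` if `j < 0`. -/
def hilbertFunction {n : ℕ} (Z : Finset (PSpace n)) : ℤ → ℕ
  | Int.ofNat j => Module.finrank ℂ (LinearMap.range (evalMap (fun P : Z => (P : PSpace n).rep) j))
  | Int.negSucc _ => 0

/-- The Hilbert function does not depend on the choice of representatives. -/
theorem hilbertFunction_eq {n : ℕ} (Z : Finset (PSpace n)) (Y : Z → Fin (n + 1) → ℂ)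
    (hY : ∀ P, Y P ≠ 0) (h : ∀ P : Z, Projectivization.mk ℂ (Y P) (hY P) = P) (j : ℕ) :
    hilbertFunction Z (j : ℤ) = Module.finrank ℂ (LinearMap.range (evalMap Y j)) := by
  have h1 : ∀ P : Z, ∃ a : ℂˣ, a • Y P = (P : PSpace n).rep := fun P => by
    have := Projectivization.exists_smul_eq_mk_rep ℂ (Y P) (hY P)
    rwa [h P] at this
  choose a ha using h1
  let e : (Z → ℂ) ≃ₗ[ℂ] (Z → ℂ) := LinearEquiv.piCongrRight fun P =>
    LinearEquiv.smulOfUnit (a P ^ j)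
  have h2 : evalMap (fun P : Z => (P : PSpace n).rep) j = e.toLinearMap ∘ₗ evalMap Y j := by
    ext F P
    have hF : (F : MvPolynomial (Fin (n + 1)) ℂ).IsHomogeneous j := F.2
    have h4 : MvPolynomial.eval ((a P : ℂ) • Y P) (F : MvPolynomial (Fin (n + 1)) ℂ) =
        (a P : ℂ) ^ j * MvPolynomial.eval (Y P) (F : MvPolynomial (Fin (n + 1)) ℂ) := by
      rw [MvPolynomial.eval_eq', MvPolynomial.eval_eq', Finset.mul_sum]
      refine Finset.sum_congr rfl fun d hd => ?_
      have hd' : ∑ i, d i = j := by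
        rw [← hF (MvPolynomial.mem_support_iff.mp hd), Finsupp.weight_apply,
          Finsupp.sum_fintype _ _ (by simp)]
        simp
      simp only [Pi.smul_apply, smul_eq_mul, mul_pow, Finset.prod_mul_distrib,
        Finset.prod_pow_eq_pow_sum, hd']
      ring
    have h5 : (P : PSpace n).rep = (a P : ℂ) • Y P := (ha P).symm
    change MvPolynomial.eval (P : PSpace n).rep (F : MvPolynomial (Fin (n + 1)) ℂ) =
      (a P ^ j) • MvPolynomial.eval (Y P) (F : MvPolynomial (Fin (n + 1)) ℂ)
    rw [h5, h4, Units.smul_def, smul_eq_mul, Units.val_pow_eq_pow_val]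
  change Module.finrank ℂ (LinearMap.range (evalMap (fun P : Z => (P : PSpace n).rep) j)) = _
  rw [h2, LinearMap.range_comp]
  exact LinearEquiv.finrank_map_eq e _

/-- The degree `n` monomials `(sⁿ, sⁿ⁻¹t, …, tⁿ)` evaluated at `(s, t) = (v 0, v 1)`. -/
def veroneseVec (n : ℕ) (v : Fin (1 + 1) → ℂ) : Fin (n + 1) → ℂ :=
  fun i => v 0 ^ (n - (i : ℕ)) * v 1 ^ (i : ℕ)

theorem veroneseVec_ne_zero (n : ℕ) {v : Fin (1 + 1) → ℂ} (hv : v ≠ 0) : veroneseVec n v ≠ 0 := by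
  intro h
  have h0 := congrFun h 0
  have h1 := congrFun h (Fin.last n)
  simp [veroneseVec] at h0 h1
  apply hv
  ext i
  fin_cases i
  · exact h0.1
  · exact h1.1

theorem veroneseVec_smul (n : ℕ) (c : ℂ) (v : Fin (1 + 1) → ℂ) :
    veroneseVec n (c • v) = c ^ n • veroneseVec n v := by
  ext i
  have hi : n - (i : ℕ) + (i : ℕ) = n := Nat.sub_add_cancel (Nat.lt_succ_iff.mp i.2)
  simp only [veroneseVec, Pi.smul_apply, smul_eq_mul, mul_pow]
  calc _ = c ^ (n - (i : ℕ) + (i : ℕ)) * (v 0 ^ (n - (i : ℕ)) * v 1 ^ (i : ℕ)) := by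
        rw [pow_add]; ring
    _ = _ := by rw [hi]

/-- The Veronese map `ν_n : ℙ¹ → ℙⁿ`, `[s : t] ↦ [sⁿ : sⁿ⁻¹t : … : tⁿ]`. -/
def veroneseMap (n : ℕ) : PSpace 1 → PSpace n :=
  Projectivization.lift
    (fun v => Projectivization.mk ℂ (veroneseVec n v.1) (veroneseVec_ne_zero n v.2))
    (by
      rintro ⟨v, hv⟩ ⟨w, hw⟩ t (rfl : v = t • w)
      rw [Projectivization.mk_eq_mk_iff']
      exact ⟨t ^ n, (veroneseVec_smul n t w).symm⟩)

/-- A rational normal curve in `ℙⁿ`: the image of `ν_n : ℙ¹ → ℙⁿ`, up to a linear change of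
coordinates in `ℙⁿ`. -/
def IsRationalNormalCurve {n : ℕ} (Γ : Set (PSpace n)) : Prop :=
  ∃ g : (Fin (n + 1) → ℂ) ≃ₗ[ℂ] (Fin (n + 1) → ℂ),
    Γ = Set.range fun P => Projectivization.map g.toLinearMap g.injective (veroneseMap n P)

end

/-! This is Castelnuovo's argument, run on linear relations `∑ c z • (v z ⊗ v z) = 0` between
squares of representatives. They are dual to evaluation of quadrics, so `h_Z(2) ≤ 2n + 1` gives a
nonzero relation on any `2n + 2` points of `Z`.

Contracting a relation with a linear form that vanishes at `n` of the points leaves a linear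
relation between the others. So `2n + 1` points in general position have independent squares, and a
further point whose square depends on theirs keeps general position
(`InGeneralPosition.insert_of_isSquareRelation`). Exchanging points one at a time spreads general
position from `A` to `Z` (`InGeneralPosition.of_subset`).

For the curve, take `n + 1` points of `Z` as a basis. Comparing relations shows that the
coordinatewise inverses of the other points all lie on the line through two of them
(`InGeneralPosition.exists_inverse_coordinates`). Inverting coordinates along this line and clearing
denominators gives products of `n` binary linear forms, which parametrize a rational normal curve
that also passes through the basis points (`exists_linearEquiv_veroneseVec`). -/

/-! ### General position and relations between squares. -/

section GeneralPosition

variable {K V ι : Type*} [Field K] [AddCommGroup V] [Module K V]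

/-- A finite family of vectors is in general position in dimension `m` if any `m` of its members
are linearly independent. -/
def InGeneralPosition (K : Type*) {V ι : Type*} [Field K] [AddCommGroup V] [Module K V]
    (v : ι → V) (m : ℕ) (A : Finset ι) : Prop :=
  ∀ B ⊆ A, B.card = m → LinearIndepOn K v (B : Set ι)

/-- The coefficients `c` form a linear relation between the squares `v z ⊗ v z`, `z ∈ T`. -/
def IsSquareRelation (v : ι → V) (T : Finset ι) (c : ι → K) : Prop :=
  ∀ φ : Module.Dual K V, ∑ z ∈ T, (c z * φ (v z)) • v z = 0

theorem InGeneralPosition.mono {v : ι → V} {m : ℕ} {A B : Finset ι}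
    (hA : InGeneralPosition K v m A) (h : B ⊆ A) : InGeneralPosition K v m B :=
  fun C hC => hA C (hC.trans h)

theorem InGeneralPosition.linearIndepOn {v : ι → V} {m : ℕ} {A B : Finset ι}
    (hA : InGeneralPosition K v m A) (hm : m ≤ A.card) (h : B ⊆ A) (hB : B.card ≤ m) :
    LinearIndepOn K v (B : Set ι) := by
  obtain ⟨C, hBC, hCA, hC⟩ := Finset.exists_subsuperset_card_eq h hB hm
  exact (hA C hCA hC).mono (by exact_mod_cast hBC)

theorem LinearIndepOn.exists_dual_eq_one {v : ι → V} {B : Set ι} (hB : LinearIndepOn K v B)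
    {a : ι} (ha : a ∈ B) :
    ∃ φ : Module.Dual K V, φ (v a) = 1 ∧ ∀ s ∈ B, s ≠ a → φ (v s) = 0 := by
  have h1 : LinearIndepOn K v (insert a (B \ {a})) := by
    rwa [Set.insert_sdiff_singleton, Set.insert_eq_of_mem ha]
  obtain ⟨φ, hφ, hker⟩ := Submodule.exists_le_ker_of_notMem
    ((linearIndepOn_insert (by simp)).1 h1).2
  refine ⟨(φ (v a))⁻¹ • φ, by simp [hφ], fun s hs hsa => ?_⟩
  have : φ (v s) = 0 := hker (Submodule.subset_span ⟨s, ⟨hs, hsa⟩, rfl⟩)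
  simp [this]

theorem LinearIndepOn.dual_eq_zero [FiniteDimensional K V] {v : ι → V} {B : Finset ι}
    (hB : LinearIndepOn K v (B : Set ι)) (hcard : B.card = Module.finrank K V)
    {φ : Module.Dual K V} (h : ∀ b ∈ B, φ (v b) = 0) : φ = 0 := by
  have hspan := LinearIndependent.span_eq_top_of_card_eq_finrank' hB (by simpa using hcard)
  have hle : (⊤ : Submodule K V) ≤ LinearMap.ker φ := by
    rw [← hspan, Submodule.span_le]
    rintro _ ⟨b, rfl⟩
    exact h b b.2
  exact LinearMap.ext fun x => hle (Submodule.mem_top (x := x))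

variable [FiniteDimensional K V] [DecidableEq ι] {v : ι → V} {n : ℕ}

/-- A nonzero linear form vanishing at `n` points in general position vanishes at no other point. -/
theorem InGeneralPosition.dual_ne_zero (hV : Module.finrank K V = n + 1) {A S : Finset ι}
    (hA : InGeneralPosition K v (n + 1) A) (hS : S ⊆ A) (hcard : S.card = n)
    {φ : Module.Dual K V} (hφ : φ ≠ 0) (h0 : ∀ s ∈ S, φ (v s) = 0) {a : ι} (ha : a ∈ A)
    (haS : a ∉ S) : φ (v a) ≠ 0 := by
  intro h
  refine hφ ((hA (insert a S) (Finset.insert_subset ha hS) ?_).dual_eq_zero ?_ ?_)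
  · rw [Finset.card_insert_of_notMem haS, hcard]
  · rw [Finset.card_insert_of_notMem haS, hcard, hV]
  · simpa using ⟨h, h0⟩

omit [FiniteDimensional K V] in
theorem InGeneralPosition.exists_dual {A S : Finset ι}
    (hA : InGeneralPosition K v (n + 1) A) (hS : S ⊆ A) (hcard : S.card = n) {a : ι} (ha : a ∈ A)
    (haS : a ∉ S) : ∃ φ : Module.Dual K V, φ ≠ 0 ∧ ∀ s ∈ S, φ (v s) = 0 := by
  have hB := hA (insert a S) (Finset.insert_subset ha hS)
    (by rw [Finset.card_insert_of_notMem haS, hcard])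
  obtain ⟨φ, h1, h2⟩ := hB.exists_dual_eq_one (a := a) (by simp)
  refine ⟨φ, fun h => by simp [h] at h1, fun s hs => h2 s (by simp [hs]) ?_⟩
  rintro rfl
  exact haS hs

/-- The form `φ` removes the `n` points of `S`; the remaining `n + 1` are independent and `φ`
vanishes at none of them. -/
theorem InGeneralPosition.coeff_eq_zero (hV : Module.finrank K V = n + 1) {A S : Finset ι}
    (hA : InGeneralPosition K v (n + 1) A) (hAcard : A.card = 2 * n + 1) (hS : S ⊆ A)
    (hcard : S.card = n) {φ : Module.Dual K V} (hφ : φ ≠ 0) (h0 : ∀ s ∈ S, φ (v s) = 0)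
    {c : ι → K} (hc : ∑ z ∈ A, (c z * φ (v z)) • v z = 0) {a : ι} (ha : a ∈ A) (haS : a ∉ S) :
    c a = 0 := by
  have hsum : ∑ z ∈ A \ S, (c z * φ (v z)) • v z = 0 := by
    rw [← hc]
    refine Finset.sum_subset Finset.sdiff_subset fun z hz hz' => ?_
    have : z ∈ S := by simpa [hz] using hz'
    simp [h0 z this]
  have hind : LinearIndepOn K v ((A \ S : Finset ι) : Set ι) :=
    hA _ Finset.sdiff_subset (by rw [Finset.card_sdiff_of_subset hS]; omega)
  have := linearIndepOn_finset_iff.1 hind (fun z => c z * φ (v z)) hsum a (by simp [ha, haS])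
  exact (mul_eq_zero.1 this).resolve_right (hA.dual_ne_zero hV hS hcard hφ h0 ha haS)

/-- The squares of `2 n + 1` vectors in general position are linearly independent. -/
theorem IsSquareRelation.eq_zero (hV : Module.finrank K V = n + 1) {A : Finset ι}
    (hA : InGeneralPosition K v (n + 1) A) (hAcard : A.card = 2 * n + 1)
    {c : ι → K} (hc : IsSquareRelation v A c) {a : ι} (ha : a ∈ A) : c a = 0 := by
  obtain ⟨S, hS, hcard⟩ := Finset.exists_subset_card_eq (s := A.erase a) (n := n)
    (by rw [Finset.card_erase_of_mem ha]; omega)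
  have haS : a ∉ S := fun h => by simpa using hS h
  have hSA := hS.trans (Finset.erase_subset a A)
  obtain ⟨φ, hφ, h0⟩ := hA.exists_dual hSA hcard ha haS
  exact hA.coeff_eq_zero hV hAcard hSA hcard hφ h0 (hc φ) ha haS

omit [FiniteDimensional K V] in
theorem IsSquareRelation.erase {T : Finset ι} {c : ι → K} (hc : IsSquareRelation v T c) {z : ι}
    (hz : c z = 0) : IsSquareRelation v (T.erase z) c := by
  intro φ
  rw [← hc φ]
  refine Finset.sum_subset (Finset.erase_subset _ _) fun w hw hw' => ?_
  have : w = z := by by_contra h; exact hw' (Finset.mem_erase.2 ⟨h, hw⟩)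
  simp [this, hz]

/-- All coefficients of a nonzero relation between the squares of `2 n + 2` vectors in general
position are nonzero. -/
theorem IsSquareRelation.coeff_ne_zero (hV : Module.finrank K V = n + 1) {T : Finset ι}
    (hT : InGeneralPosition K v (n + 1) T) (hcard : T.card = 2 * n + 2)
    {c : ι → K} (hc : IsSquareRelation v T c) (hne : ∃ z ∈ T, c z ≠ 0) {a : ι} (ha : a ∈ T) :
    c a ≠ 0 := by
  intro h
  obtain ⟨z, hz, hcz⟩ := hne
  have hza : z ≠ a := by rintro rfl; exact hcz h
  exact hcz ((hc.erase h).eq_zero hV (hT.mono (Finset.erase_subset _ _))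
    (by rw [Finset.card_erase_of_mem ha]; omega) (Finset.mem_erase.2 ⟨hza, hz⟩))

/-- If the square of `v p` depends on the squares of `2 n + 1` vectors in general position, then
adding `v p` preserves general position. -/
theorem InGeneralPosition.insert_of_isSquareRelation (hV : Module.finrank K V = n + 1)
    (hpair : ∀ a p : ι, a ≠ p → ∀ k : K, v a ≠ k • v p) (hv : ∀ a, v a ≠ 0) {A : Finset ι}
    (hA : InGeneralPosition K v (n + 1) A) (hAcard : A.card = 2 * n + 1) {p : ι} (hp : p ∉ A)
    {c : ι → K} (hc : IsSquareRelation v (insert p A) c) (hne : ∃ z ∈ insert p A, c z ≠ 0) :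
    InGeneralPosition K v (n + 1) (insert p A) := by
  have hcp : c p ≠ 0 := by
    intro h
    have hc' := hc.erase h
    rw [Finset.erase_insert hp] at hc'
    obtain ⟨z, hz, hcz⟩ := hne
    rcases Finset.mem_insert.1 hz with rfl | hz
    · exact hcz h
    · exact hcz (hc'.eq_zero hV hA hAcard hz)
  intro B hB hBcard
  by_cases hpB : p ∈ B
  swap
  · exact hA B ((Finset.subset_insert_iff_of_notMem hpB).1 hB) hBcard
  obtain ⟨S, hpS, rfl⟩ : ∃ S, p ∉ S ∧ insert p S = B :=
    ⟨B.erase p, Finset.notMem_erase _ _, Finset.insert_erase hpB⟩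
  have hSA : S ⊆ A := (Finset.insert_subset_insert_iff hpS).1 hB
  have hScard : S.card = n := by rw [Finset.card_insert_of_notMem hpS] at hBcard; omega
  have hSind : LinearIndepOn K v (S : Set ι) :=
    hA.linearIndepOn (by omega) hSA (by omega)
  rw [Finset.coe_insert]
  -- If `v p` lay in the span of `S`, a form vanishing on `S` would also kill `p`, forcing `c` to
  -- vanish on `A` outside `S`.
  refine hSind.insert fun hspan => ?_
  obtain ⟨a, haA, haS⟩ : ∃ a ∈ A, a ∉ S := by
    by_contra! h
    have := Finset.card_le_card (show A ⊆ S from h)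
    have : n = 0 := by omega
    subst this
    have : S = ∅ := Finset.card_eq_zero.1 hScard
    subst this
    simp at hspan
    exact hv p hspan
  obtain ⟨φ, hφ, h0⟩ := hA.exists_dual hSA hScard haA haS
  have hφp : φ (v p) = 0 := by
    have : Submodule.span K (v '' (S : Set ι)) ≤ LinearMap.ker φ := by
      rw [Submodule.span_le]
      rintro _ ⟨s, hs, rfl⟩
      exact h0 s hs
    exact this hspan
  have hout : ∀ z ∈ A, z ∉ S → c z = 0 := by
    intro z hz hzS
    refine hA.coeff_eq_zero hV hAcard hSA hScard hφ h0 ?_ hz hzS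
    have := hc φ
    rwa [Finset.sum_insert hp, hφp, mul_zero, zero_smul, zero_add] at this
  have hall : ∀ z ∈ A, c z = 0 := by
    intro z hz
    by_contra hcz
    have hzS : z ∈ S := by by_contra h; exact hcz (hout z hz h)
    -- Contracting with the form dual to `z` within `S` leaves only `z` and `p`, so `v z` would be a
    -- multiple of `v p`.
    obtain ⟨ψ, h1, h2⟩ := hSind.exists_dual_eq_one (a := z) (by simpa using hzS)
    have hrel := hc ψ
    rw [Finset.sum_insert hp, Finset.sum_eq_single_of_mem z hz, h1, mul_one] at hrel
    · refine hpair z p (by rintro rfl; exact hp hz) (-((c z)⁻¹ * (c p * ψ (v p)))) ?_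
      rw [neg_smul, mul_smul, eq_neg_iff_add_eq_zero, ← smul_right_injective V hcz |>.eq_iff]
      simp only [smul_add, smul_inv_smul₀ hcz, smul_zero]
      rw [add_comm]
      exact hrel
    · intro w hw hwz
      by_cases hwS : w ∈ S
      · rw [h2 w (by simpa using hwS) hwz, mul_zero, zero_smul]
      · rw [hout w hw hwS, zero_mul, zero_smul]
  have hp1 : LinearIndepOn K v ({p} : Set ι) := LinearIndepOn.singleton (hv p)
  obtain ⟨ψ, h1, -⟩ := hp1.exists_dual_eq_one (Set.mem_singleton p)
  have hrel := hc ψ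
  rw [Finset.sum_insert hp, h1, Finset.sum_eq_zero fun z hz => by rw [hall z hz, zero_mul, zero_smul]]
    at hrel
  simp [hcp, hv p] at hrel

/-- If `Z` contains `2 n + 1` vectors in general position, and the squares of any `2 n + 2` vectors
of `Z` are linearly dependent, then `Z` is in general position. -/
theorem InGeneralPosition.of_subset (hV : Module.finrank K V = n + 1)
    (hpair : ∀ a p : ι, a ≠ p → ∀ k : K, v a ≠ k • v p) (hv : ∀ a, v a ≠ 0) {Z : Finset ι}
    (hrel : ∀ T ⊆ Z, T.card = 2 * n + 2 →
      ∃ c : ι → K, IsSquareRelation v T c ∧ ∃ z ∈ T, c z ≠ 0)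
    {A : Finset ι} (hAZ : A ⊆ Z) (hA : InGeneralPosition K v (n + 1) A)
    (hAcard : A.card = 2 * n + 1) : InGeneralPosition K v (n + 1) Z := by
  intro B hB hBcard
  -- Each step trades a point of `A` outside `B` for a point of `B`, until `B ⊆ A`.
  induction hk : (B \ A).card generalizing A with
  | zero =>
    exact hA B (Finset.sdiff_eq_empty_iff_subset.1 (Finset.card_eq_zero.1 hk)) hBcard
  | succ k ih =>
    obtain ⟨p, hp⟩ : (B \ A).Nonempty := Finset.card_pos.1 (by omega)
    obtain ⟨hpB, hpA⟩ := Finset.mem_sdiff.1 hp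
    obtain ⟨a, ha⟩ : (A \ B).Nonempty := by
      rw [← Finset.card_pos]
      have h1 := Finset.card_sdiff_add_card_inter A B
      have h2 := Finset.card_sdiff_add_card_inter B A
      rw [Finset.inter_comm] at h2
      omega
    obtain ⟨haA, haB⟩ := Finset.mem_sdiff.1 ha
    have hcard : (insert p A).card = 2 * n + 2 := by
      rw [Finset.card_insert_of_notMem hpA, hAcard]
    have hsub : insert p A ⊆ Z := Finset.insert_subset (hB hpB) hAZ
    obtain ⟨c, hc, hne⟩ := hrel _ hsub hcard
    have hgen := hA.insert_of_isSquareRelation hV hpair hv hAcard hpA hc hne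
    refine ih (A := (insert p A).erase a) ((Finset.erase_subset _ _).trans hsub)
      (hgen.mono (Finset.erase_subset _ _)) ?_ ?_
    · rw [Finset.card_erase_of_mem (by simp [haA]), hcard]; omega
    · have : B \ (insert p A).erase a = (B \ A).erase p := by
        ext z
        simp only [Finset.mem_sdiff, Finset.mem_erase, Finset.mem_insert]
        constructor
        · rintro ⟨h1, h2⟩
          have : z ≠ a := by rintro rfl; exact haB h1
          tauto
        · tauto
      rw [this, Finset.card_erase_of_mem hp]
      omega

/-! ### Coordinates in a basis of points, and their inverses. -/

omit [FiniteDimensional K V] [DecidableEq ι] in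
theorem IsSquareRelation.apply_apply {T : Finset ι} {c : ι → K} (hc : IsSquareRelation v T c)
    (φ ψ : Module.Dual K V) : ∑ z ∈ T, c z * φ (v z) * ψ (v z) = 0 := by
  simpa using congrArg ψ (hc φ)

-- Contracting with two forms that together kill all points but two turns a relation into a scalar
-- equation between these two.
omit [FiniteDimensional K V] in
theorem IsSquareRelation.add_eq_zero {T : Finset ι} {c : ι → K} (hc : IsSquareRelation v T c)
    {φ ψ : Module.Dual K V} {e a : ι} (he : e ∈ T) (ha : a ∈ T) (hea : e ≠ a)
    (h : ∀ z ∈ T, z ≠ e → z ≠ a → φ (v z) = 0 ∨ ψ (v z) = 0) :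
    c e * φ (v e) * ψ (v e) + c a * φ (v a) * ψ (v a) = 0 := by
  rw [← hc.apply_apply φ ψ, ← Finset.sum_pair (f := fun z => c z * φ (v z) * ψ (v z)) hea]
  refine Finset.sum_subset ?_ fun z hz hz' => ?_
  · simp [Finset.insert_subset_iff, he, ha]
  · simp only [Finset.mem_insert, Finset.mem_singleton, not_or] at hz'
    rcases h z hz hz'.1 hz'.2 with h | h <;> simp [h]

/-- Two relations differing in one vector: with respect to the basis `E`, the coordinates of these
vectors times the coefficients of the opposite relations agree up to a constant. -/
theorem IsSquareRelation.exists_mul_eq (hV : Module.finrank K V = n + 1) {Z E S : Finset ι}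
    (hZ : InGeneralPosition K v (n + 1) Z) (hS : S ⊆ Z) (hScard : S.card = n)
    {x : ι → Module.Dual K V} (hx1 : ∀ e ∈ E, x e (v e) = 1)
    (hx0 : ∀ e ∈ E, ∀ e' ∈ E, e' ≠ e → x e (v e') = 0)
    {a b : ι} (ha : a ∈ Z) (hb : b ∈ Z) (haS : a ∉ S) (hbS : b ∉ S) (haE : a ∉ E) (hbE : b ∉ E)
    {c₁ c₂ : ι → K} (h₁ : IsSquareRelation v (insert a (E ∪ S)) c₁)
    (h₂ : IsSquareRelation v (insert b (E ∪ S)) c₂) (hc₁ : c₁ a ≠ 0) (hc₂ : c₂ b ≠ 0) :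
    ∃ σ : K, σ ≠ 0 ∧ ∀ e ∈ E, x e (v a) * c₂ e = σ * (x e (v b) * c₁ e) := by
  -- The same `φ` serves both relations, so the factor `φ (v e)` cancels when the two coordinates
  -- are compared.
  obtain ⟨φ, hφ, h0⟩ := hZ.exists_dual hS hScard ha haS
  have hφa := hZ.dual_ne_zero hV hS hScard hφ h0 ha haS
  have hφb := hZ.dual_ne_zero hV hS hScard hφ h0 hb hbS
  have key : ∀ {w : ι} {c : ι → K}, w ∉ E → IsSquareRelation v (insert w (E ∪ S)) c → ∀ e ∈ E,
      c e * φ (v e) + c w * φ (v w) * x e (v w) = 0 := by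
    intro w c hw hc e he
    have := hc.add_eq_zero (φ := φ) (ψ := x e) (e := e) (a := w) (by simp [he]) (by simp)
      (by rintro rfl; exact hw he) ?_
    · rwa [hx1 e he, mul_one] at this
    · intro z hz hze hzw
      simp only [Finset.mem_insert, hzw, Finset.mem_union, false_or] at hz
      rcases hz with hz | hz
      · exact Or.inr (hx0 e he z hz hze)
      · exact Or.inl (h0 z hz)
  refine ⟨c₂ b * φ (v b) / (c₁ a * φ (v a)),
    div_ne_zero (mul_ne_zero hc₂ hφb) (mul_ne_zero hc₁ hφa), fun e he => ?_⟩
  have e1 := key haE h₁ e he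
  have e2 := key hbE h₂ e he
  field_simp
  linear_combination c₂ e * e1 - c₁ e * e2

/-- With respect to a basis taken from `Z`, the coordinatewise inverses of any three further
vectors of `Z` are linearly dependent. -/
theorem InGeneralPosition.exists_inverse_coordinates (hV : Module.finrank K V = n + 1) (hn : 1 ≤ n)
    {Z E : Finset ι} (hZ : InGeneralPosition K v (n + 1) Z) (hZcard : 2 * n + 3 ≤ Z.card)
    (hrel : ∀ T ⊆ Z, T.card = 2 * n + 2 →
      ∃ c : ι → K, IsSquareRelation v T c ∧ ∃ z ∈ T, c z ≠ 0)
    (hE : E ⊆ Z) (hEcard : E.card = n + 1)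
    {x : ι → Module.Dual K V} (hx1 : ∀ e ∈ E, x e (v e) = 1)
    (hx0 : ∀ e ∈ E, ∀ e' ∈ E, e' ≠ e → x e (v e') = 0)
    {a b c : ι} (ha : a ∈ Z) (hb : b ∈ Z) (hc : c ∈ Z) (haE : a ∉ E) (hbE : b ∉ E) (hcE : c ∉ E)
    (hab : a ≠ b) (hac : a ≠ c) (hbc : b ≠ c) :
    ∃ p q : K, ∀ e ∈ E, x e (v a) * x e (v b) = x e (v c) * (p * x e (v b) + q * x e (v a)) := by
  -- Removing `E`, `a`, `b`, `c` from at least `2n + 3` points leaves at least `n - 1`; `S` with one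
  -- of `a`, `b`, `c` has `n` points, as `exists_mul_eq` requires.
  obtain ⟨S, hS, hScard⟩ := Finset.exists_subset_card_eq (s := Z \ (E ∪ {a, b, c})) (n := n - 1)
    (by
      have h1 := Finset.le_card_sdiff (E ∪ {a, b, c}) Z
      have h2 := Finset.card_union_le E {a, b, c}
      have h3 := Finset.card_le_three (a := a) (b := b) (c := c)
      omega)
  have hSZ : S ⊆ Z := hS.trans Finset.sdiff_subset
  have hSmem : ∀ z ∈ S, z ∉ E ∧ z ≠ a ∧ z ≠ b ∧ z ≠ c := fun z hz => by
    have h := (Finset.mem_sdiff.1 (hS hz)).2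
    simp only [Finset.mem_union, Finset.mem_insert, Finset.mem_singleton] at h
    tauto
  have haS : a ∉ S := fun h => (hSmem a h).2.1 rfl
  have hbS : b ∉ S := fun h => (hSmem b h).2.2.1 rfl
  have hcS : c ∉ S := fun h => (hSmem c h).2.2.2 rfl
  have hdisj : Disjoint E S := Finset.disjoint_right.2 fun z hz => (hSmem z hz).1
  have hrel' : ∀ z w : ι, z ∈ Z → w ∈ Z → z ≠ w → z ∉ E → w ∉ E → z ∉ S → w ∉ S →
      insert z (E ∪ insert w S) ⊆ Z ∧ (insert z (E ∪ insert w S)).card = 2 * n + 2 := by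
    intro z w hz hw hzw hzE hwE hzS hwS
    refine ⟨Finset.insert_subset hz (Finset.union_subset hE (Finset.insert_subset hw hSZ)), ?_⟩
    rw [Finset.card_insert_of_notMem (by simp [hzw, hzE, hzS]), Finset.card_union_of_disjoint
      (by simp [hwE, hdisj]), Finset.card_insert_of_notMem hwS]
    omega
  obtain ⟨hTa, hTa'⟩ := hrel' b c hb hc hbc hbE hcE hbS hcS
  obtain ⟨hTb, hTb'⟩ := hrel' a c ha hc hac haE hcE haS hcS
  obtain ⟨ra, hra, hra0⟩ := hrel _ hTa hTa'
  obtain ⟨rb, hrb, hrb0⟩ := hrel _ hTb hTb'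
  have hra1 := fun z (hz : z ∈ insert b (E ∪ insert c S)) =>
    hra.coeff_ne_zero hV (hZ.mono hTa) hTa' hra0 hz
  have hrb1 := fun z (hz : z ∈ insert a (E ∪ insert c S)) =>
    hrb.coeff_ne_zero hV (hZ.mono hTb) hTb' hrb0 hz
  -- both relations are extended by zero, and `c` is eliminated
  set ra' : ι → K := fun z => if z = a then 0 else ra z with hra'
  set rb' : ι → K := fun z => if z = b then 0 else rb z with hrb'
  set rc : ι → K := fun z => rb c * ra' z - ra c * rb' z with hrc
  have hrcrel : IsSquareRelation v (insert b (E ∪ insert a S)) rc := by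
    intro φ
    have e1 : ∑ z ∈ insert a (insert b (E ∪ insert c S)), (ra' z * φ (v z)) • v z = 0 := by
      rw [Finset.sum_insert (by simp [hab, haE, hac, haS]), ← hra φ]
      simp only [hra', if_true, zero_mul, zero_smul, zero_add]
      refine Finset.sum_congr rfl fun z hz => ?_
      rw [if_neg]
      rintro rfl
      simp [hab, haE, hac, haS] at hz
    have e2 : ∑ z ∈ insert b (insert a (E ∪ insert c S)), (rb' z * φ (v z)) • v z = 0 := by
      rw [Finset.sum_insert (by simp [hab.symm, hbE, hbc, hbS]), ← hrb φ]
      simp only [hrb', if_true, zero_mul, zero_smul, zero_add]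
      refine Finset.sum_congr rfl fun z hz => ?_
      rw [if_neg]
      rintro rfl
      simp [hab.symm, hbE, hbc, hbS] at hz
    rw [Finset.insert_comm] at e1
    have e3 : insert b (insert a (E ∪ insert c S)) = insert c (insert b (E ∪ insert a S)) := by
      ext z; simp only [Finset.mem_insert, Finset.mem_union]; tauto
    have e4 : ∑ z ∈ insert b (insert a (E ∪ insert c S)), (rc z * φ (v z)) • v z = 0 := by
      simp only [hrc, sub_mul, sub_smul, Finset.sum_sub_distrib, mul_assoc, mul_smul,
        ← Finset.smul_sum]
      simp only [← mul_smul]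
      rw [e1, e2, smul_zero, smul_zero, sub_zero]
    rw [e3, Finset.sum_insert (by simp [hbc.symm, hcE, hac.symm, hcS])] at e4
    have : rc c = 0 := by
      simp only [hrc, hra', hrb', if_neg hac.symm, if_neg hbc.symm]; ring
    rwa [this, zero_mul, zero_smul, zero_add] at e4
  have hrcb : rc b ≠ 0 := by
    simp only [hrc, hra', hrb', if_neg hab.symm, if_true, mul_zero, sub_zero]
    exact mul_ne_zero (hrb1 c (by simp)) (hra1 b (by simp))
  have hrb'' : IsSquareRelation v (insert c (E ∪ insert a S)) rb := by
    have : insert a (E ∪ insert c S) = insert c (E ∪ insert a S) := by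
      ext z; simp only [Finset.mem_insert, Finset.mem_union]; tauto
    rwa [this] at hrb
  have hcard : ∀ w, w ∉ S → (insert w S).card = n := fun w hw => by
    rw [Finset.card_insert_of_notMem hw]; omega
  obtain ⟨σ, hσ, hσe⟩ := hrb.exists_mul_eq hV hZ (Finset.insert_subset hc hSZ) (hcard c hcS)
    hx1 hx0 ha hb (by simp [hac, haS]) (by simp [hbc, hbS]) haE hbE hra
    (hrb1 a (by simp)) (hra1 b (by simp))
  obtain ⟨τ, hτ, hτe⟩ := hrcrel.exists_mul_eq hV hZ (Finset.insert_subset ha hSZ) (hcard a haS)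
    hx1 hx0 hb hc (by simp [hab.symm, hbS]) (by simp [hac.symm, hcS]) hbE hcE hrb''
    hrcb (hrb1 c (by simp))
  -- Up to constants independent of `e`, the products `x e (v a) * ra e`, `x e (v b) * rb e` and `x
  -- e (v c) * rc e` agree. Hence `rc = rb c * ra - ra c * rb` on `E` becomes a linear relation
  -- between the inverse coordinates.
  refine ⟨τ * rb c * σ, -(τ * ra c), fun e he => ?_⟩
  have h1 := hσe e he
  have h2 := hτe e he
  have hea : e ≠ a := by rintro rfl; exact haE he
  have heb : e ≠ b := by rintro rfl; exact hbE he
  simp only [hrc, hra', hrb', if_neg hea, if_neg heb] at h2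
  have hrbe : rb e ≠ 0 := hrb1 e (by simp [he])
  apply mul_right_cancel₀ hrbe
  linear_combination x e (v a) * h2 + τ * x e (v c) * rb c * h1

end GeneralPosition

/-! ### Coordinate expansion and distinctness of coordinate ratios. -/

section GeneralPosition

variable {K V ι : Type*} [Field K] [AddCommGroup V] [Module K V] [FiniteDimensional K V]
  [DecidableEq ι] {v : ι → V} {n : ℕ}

omit [DecidableEq ι] in
theorem LinearIndepOn.eq_sum_dual {E : Finset ι}
    (hE : LinearIndepOn K v (E : Set ι)) (hcard : E.card = Module.finrank K V)
    {x : ι → Module.Dual K V} (hx1 : ∀ e ∈ E, x e (v e) = 1)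
    (hx0 : ∀ e ∈ E, ∀ e' ∈ E, e' ≠ e → x e (v e') = 0) (u : V) :
    u = ∑ e ∈ E, x e u • v e := by
  have hspan := LinearIndependent.span_eq_top_of_card_eq_finrank' hE (by simpa using hcard)
  rw [← Set.image_eq_range] at hspan
  have hu : u ∈ Submodule.span K (v '' (E : Set ι)) := hspan ▸ Submodule.mem_top
  obtain ⟨f, hf⟩ := Submodule.mem_span_image_finset_iff_exists_fun' .. |>.1 hu
  rw [← hf]
  refine Finset.sum_congr rfl fun e he => ?_
  rw [map_sum, Finset.sum_eq_single_of_mem e he]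
  · rw [map_smul, hx1 e he, smul_eq_mul, mul_one]
  · intro e' he' hne
    rw [map_smul, hx0 e he e' he' hne, smul_zero]

/-- The ratios of the coordinates of two vectors in general position are distinct. -/
theorem InGeneralPosition.coordinates_mul_ne (hV : Module.finrank K V = n + 1)
    {Z E : Finset ι} (hZ : InGeneralPosition K v (n + 1) Z) (hE : E ⊆ Z) (hEcard : E.card = n + 1)
    {x : ι → Module.Dual K V} (hx1 : ∀ e ∈ E, x e (v e) = 1)
    (hx0 : ∀ e ∈ E, ∀ e' ∈ E, e' ≠ e → x e (v e') = 0)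
    {a b : ι} (ha : a ∈ Z) (hb : b ∈ Z) (haE : a ∉ E) (hbE : b ∉ E) (hab : a ≠ b)
    (hxa : ∀ e ∈ E, x e (v a) ≠ 0) {e e' : ι} (he : e ∈ E) (he' : e' ∈ E) (hee' : e ≠ e') :
    x e (v b) * x e' (v a) ≠ x e' (v b) * x e (v a) := by
  intro h
  have haS : a ∉ (E.erase e).erase e' := fun h => haE (Finset.mem_of_mem_erase
    (Finset.mem_of_mem_erase h))
  have hcard : (insert a ((E.erase e).erase e')).card = n := by
    rw [Finset.card_insert_of_notMem haS, Finset.card_erase_of_mem, Finset.card_erase_of_mem he]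
    · have : 1 < E.card := Finset.one_lt_card.2 ⟨e, he, e', he', hee'⟩
      omega
    · simp [hee'.symm, he']
  -- This form vanishes at `a` and at the `n - 1` points of `E` other than `e`, `e'`, hence not at
  -- `b`.
  refine hZ.dual_ne_zero hV (S := insert a ((E.erase e).erase e'))
    (φ := x e (v a) • x e' - x e' (v a) • x e) ?_ hcard ?_ ?_ hb ?_ ?_
  · exact Finset.insert_subset ha (((Finset.erase_subset _ _).trans (Finset.erase_subset _ _)).trans
      hE)
  · intro h0
    have := LinearMap.congr_fun h0 (v e')
    simp [hx1 e' he', hx0 e he e' he' hee'.symm, hxa e he] at this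
  · intro s hs
    rcases Finset.mem_insert.1 hs with rfl | hs
    · simp [mul_comm]
    · simp only [Finset.mem_erase] at hs
      simp [hx0 e he s hs.2.2 hs.2.1, hx0 e' he' s hs.2.2 hs.1]
  · simp [hab.symm, hbE]
  · simp only [LinearMap.sub_apply, LinearMap.smul_apply, smul_eq_mul]
    linear_combination -h

end GeneralPosition

/-! ### Rational normal curves from products of binary linear forms. -/

section RationalNormalCurve

/-- In the induction on the number of factors, dropping the last or the first entry of the Veronese
vector yields `w 0` or `w 1` times the Veronese vector of one degree less. -/
theorem exists_dual_veroneseVec {ι : Type*} (α β : ι → ℂ) (m : ℕ) (J : Finset ι)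
    (hJ : J.card = m) : ∃ φ : Module.Dual ℂ (Fin (m + 1) → ℂ),
      ∀ w, φ (veroneseVec m w) = ∏ j ∈ J, (w 0 * α j + w 1 * β j) := by
  classical
  induction m generalizing J with
  | zero =>
    obtain rfl := Finset.card_eq_zero.1 hJ
    exact ⟨LinearMap.proj 0, fun w => by simp [veroneseVec]⟩
  | succ m ih =>
    obtain ⟨i, J, hi, rfl, hJ'⟩ := Finset.card_eq_succ.1 hJ
    obtain ⟨φ, hφ⟩ := ih J hJ'
    refine ⟨α i • φ ∘ₗ LinearMap.funLeft ℂ ℂ Fin.castSucc + β i • φ ∘ₗ LinearMap.funLeft ℂ ℂ Fin.succ,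
      fun w => ?_⟩
    have h0 : LinearMap.funLeft ℂ ℂ Fin.castSucc (veroneseVec (m + 1) w) =
        w 0 • veroneseVec m w := by
      ext k
      have : m + 1 - (k : ℕ) = (m - k) + 1 := by omega
      simp only [LinearMap.funLeft_apply, veroneseVec, Fin.val_castSucc, Pi.smul_apply,
        smul_eq_mul, this, pow_succ]
      ring
    have h1 : LinearMap.funLeft ℂ ℂ Fin.succ (veroneseVec (m + 1) w) =
        w 1 • veroneseVec m w := by
      ext k
      have : m + 1 - ((k : ℕ) + 1) = m - k := by omega
      simp only [LinearMap.funLeft_apply, veroneseVec, Fin.val_succ, Pi.smul_apply,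
        smul_eq_mul, this, pow_succ]
      ring
    simp only [LinearMap.add_apply, LinearMap.smul_apply, LinearMap.comp_apply, h0, h1, map_smul,
      smul_eq_mul, hφ, Finset.prod_insert hi]
    ring

/-- Products of all but one of `n + 1` pairwise independent binary linear forms are the coordinates
of a rational normal curve. -/
theorem exists_linearEquiv_veroneseVec {n : ℕ} {ι : Type*} [DecidableEq ι]
    {v : ι → Fin (n + 1) → ℂ} {E : Finset ι} (hE : LinearIndepOn ℂ v (E : Set ι))
    (hcard : E.card = n + 1) {α β γ : ι → ℂ} (hγ : ∀ e ∈ E, γ e ≠ 0)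
    (hαβ : ∀ e ∈ E, ∀ j ∈ E, e ≠ j → α e * β j ≠ α j * β e) :
    ∃ g : (Fin (n + 1) → ℂ) ≃ₗ[ℂ] (Fin (n + 1) → ℂ), ∀ w, g (veroneseVec n w) =
      ∑ e ∈ E, (γ e * ∏ j ∈ E.erase e, (w 0 * α j + w 1 * β j)) • v e := by
  have hφ : ∀ e : ι, ∃ φ : Module.Dual ℂ (Fin (n + 1) → ℂ), e ∈ E →
      ∀ w, φ (veroneseVec n w) = ∏ j ∈ E.erase e, (w 0 * α j + w 1 * β j) := by
    intro e
    by_cases he : e ∈ E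
    · obtain ⟨φ, h⟩ := exists_dual_veroneseVec α β n (E.erase e)
        (by rw [Finset.card_erase_of_mem he]; omega)
      exact ⟨φ, fun _ => h⟩
    · exact ⟨0, fun h => absurd h he⟩
  choose φ hφ using hφ
  let g : (Fin (n + 1) → ℂ) →ₗ[ℂ] (Fin (n + 1) → ℂ) := ∑ e ∈ E, (γ e • φ e).smulRight (v e)
  have hg : ∀ w, g (veroneseVec n w) =
      ∑ e ∈ E, (γ e * ∏ j ∈ E.erase e, (w 0 * α j + w 1 * β j)) • v e := by
    intro w
    simp only [g, LinearMap.sum_apply, LinearMap.smulRight_apply, LinearMap.smul_apply, smul_eq_mul]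
    exact Finset.sum_congr rfl fun e he => by rw [hφ e he]
  have hsurj : Function.Surjective g := by
    rw [← LinearMap.range_eq_top, eq_top_iff,
      ← LinearIndependent.span_eq_top_of_card_eq_finrank' hE (by simpa using hcard),
      Submodule.span_le]
    rintro _ ⟨⟨e, he⟩, rfl⟩
    have he : e ∈ E := he
    -- This is the zero of the factor with index `e`, which only the `e`-th product omits; so the
    -- value is a nonzero multiple of `v e`.
    have h := hg ![β e, -α e]
    rw [Finset.sum_eq_single_of_mem e he] at h
    · have hne : γ e * ∏ j ∈ E.erase e, (β e * α j + -α e * β j) ≠ 0 := by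
        refine mul_ne_zero (hγ e he) (Finset.prod_ne_zero_iff.2 fun j hj h0 => ?_)
        rw [Finset.mem_erase] at hj
        exact hαβ e he j hj.2 hj.1.symm (by linear_combination -h0)
      refine (Submodule.smul_mem_iff _ hne).1 ?_
      exact ⟨_, h⟩
    · intro e' he' hne
      rw [Finset.prod_eq_zero (i := e), mul_zero, zero_smul]
      · simp [he, hne.symm]
      · simp only [Matrix.cons_val_zero, Matrix.cons_val_one]; ring
  exact ⟨LinearEquiv.ofBijective g ⟨LinearMap.injective_iff_surjective.2 hsurj, hsurj⟩, hg⟩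

theorem mem_range_map_veroneseMap {n : ℕ} (g : (Fin (n + 1) → ℂ) ≃ₗ[ℂ] (Fin (n + 1) → ℂ))
    {z : PSpace n} {w : Fin (1 + 1) → ℂ} (hw : w ≠ 0) {k : ℂ}
    (h : g (veroneseVec n w) = k • z.rep) :
    z ∈ Set.range fun P => Projectivization.map g.toLinearMap g.injective (veroneseMap n P) := by
  refine ⟨Projectivization.mk ℂ w hw, ?_⟩
  change Projectivization.map g.toLinearMap g.injective
    (Projectivization.mk ℂ (veroneseVec n w) (veroneseVec_ne_zero n hw)) = z
  rw [Projectivization.map_mk]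
  conv_rhs => rw [← z.mk_rep]
  rw [Projectivization.mk_eq_mk_iff']
  exact ⟨k, h.symm⟩

end RationalNormalCurve

/-! ### Translation to projective points and construction of the curve. -/

section Projective

variable {n : ℕ}

theorem independent_coe_iff (B : Finset (PSpace n)) :
    Projectivization.Independent (fun P : B => (P : PSpace n)) ↔
      LinearIndepOn ℂ (Projectivization.rep : PSpace n → Fin (n + 1) → ℂ)
        (B : Set (PSpace n)) :=
  Projectivization.independent_iff

/-- The supremum is attained, since `0` is admissible and `k ≤ ℓ(A)` is a bound; it is at most `n +
1` by dimension. -/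
theorem isLGP_iff {A : Finset (PSpace n)} (hA : n + 1 ≤ A.card) :
    IsLGP A ↔ InGeneralPosition ℂ (Projectivization.rep : PSpace n → Fin (n + 1) → ℂ) (n + 1) A := by
  have hmem : ∀ k, k ∈ {k : ℕ | k ≤ A.card ∧
      ∀ B ⊆ A, B.card = k → Projectivization.Independent (fun P : B => (P : PSpace n))} ↔
      k ≤ A.card ∧
        InGeneralPosition ℂ (Projectivization.rep : PSpace n → Fin (n + 1) → ℂ) k A := by
    intro k
    simp only [Set.mem_ofPred_eq, independent_coe_iff, InGeneralPosition]
  rw [IsLGP, min_eq_right hA, kruskalRank]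
  constructor
  · intro h
    refine ((hmem (n + 1)).1 (h.subst (motive := fun k => k ∈ _) ?_)).2
    refine Nat.sSup_mem ⟨0, (hmem 0).2 ⟨Nat.zero_le _, fun B _ hB => ?_⟩⟩ ⟨A.card, fun k hk => hk.1⟩
    obtain rfl := Finset.card_eq_zero.1 hB
    simp
  · intro h
    refine IsGreatest.csSup_eq ⟨(hmem _).2 ⟨hA, h⟩, fun k hk => ?_⟩
    obtain ⟨hk, hind⟩ := (hmem k).1 hk
    obtain ⟨B, hB, rfl⟩ := Finset.exists_subset_card_eq hk
    have hcard := (hind B hB rfl).fintype_card_le_finrank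
    simpa using hcard

/-- If `h_Z(2) < ℓ(T)` for a subset `T` of `Z`, the squares of the points of `T` are linearly
dependent. -/
theorem exists_isSquareRelation {Z T : Finset (PSpace n)} (hTZ : T ⊆ Z)
    (hT : hilbertFunction Z 2 < T.card) :
    ∃ c : PSpace n → ℂ, IsSquareRelation Projectivization.rep T c ∧ ∃ z ∈ T, c z ≠ 0 := by
  classical
  let r : (Z → ℂ) →ₗ[ℂ] (T → ℂ) := LinearMap.funLeft ℂ ℂ (fun z : T => ⟨z, hTZ z.2⟩)
  let W := (LinearMap.range (evalMap (fun P : Z => (P : PSpace n).rep) 2)).map r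
  have hW : W < ⊤ := by
    refine lt_top_iff_ne_top.2 fun h => ?_
    have h1 : Module.finrank ℂ W ≤ hilbertFunction Z 2 := Submodule.finrank_map_le _ _
    rw [h, finrank_top, Module.finrank_fintype_fun_eq_card, Fintype.card_coe] at h1
    omega
  -- The values of quadrics on `T` do not fill `T → ℂ`; the coefficients of a functional killing
  -- them form the relation.
  obtain ⟨f, hf0, hf⟩ := Submodule.exists_le_ker_of_lt_top W hW
  have hfsum : ∀ y : T → ℂ, f y = ∑ z : T, y z * f (Pi.single z 1) := fun y => by
    conv_lhs => rw [LinearMap.pi_apply_eq_sum_univ f y]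
    refine Finset.sum_congr rfl fun z _ => ?_
    rw [smul_eq_mul]
    congr 2
    ext w
    simp [Pi.single_apply, eq_comm]
  let c : PSpace n → ℂ := fun z => if h : z ∈ T then f (Pi.single ⟨z, h⟩ 1) else 0
  have hc : ∀ z : T, c z = f (Pi.single z 1) := fun z => dif_pos z.2
  refine ⟨c, fun φ => ?_, ?_⟩
  · ext k
    -- The quadric `φ · X k` tests the `k`-th component of the contraction with `φ`.
    let F : MvPolynomial (Fin (n + 1)) ℂ :=
      (∑ i, MvPolynomial.C (φ (Pi.single i 1)) * MvPolynomial.X i) * MvPolynomial.X k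
    have hF : F ∈ MvPolynomial.homogeneousSubmodule (Fin (n + 1)) ℂ 2 := by
      refine MvPolynomial.IsHomogeneous.mul (m := 1) (n := 1)
        (MvPolynomial.IsHomogeneous.sum _ _ _ fun i _ => ?_) (MvPolynomial.isHomogeneous_X _ _)
      exact (MvPolynomial.isHomogeneous_C_mul_X _ _)
    have heval : ∀ u : Fin (n + 1) → ℂ, MvPolynomial.eval u F = φ u * u k := by
      intro u
      simp only [F, map_mul, map_sum, MvPolynomial.eval_C, MvPolynomial.eval_X]
      congr 1
      conv_rhs => rw [LinearMap.pi_apply_eq_sum_univ φ u]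
      refine Finset.sum_congr rfl fun i _ => ?_
      rw [smul_eq_mul, mul_comm]
      congr 2
      ext w
      simp [Pi.single_apply, eq_comm]
    have h0 : f (r (evalMap (fun P : Z => (P : PSpace n).rep) 2 ⟨F, hF⟩)) = 0 :=
      hf ⟨_, ⟨_, rfl⟩, rfl⟩
    rw [hfsum] at h0
    rw [Finset.sum_apply, Pi.zero_apply, ← h0, ← Finset.sum_coe_sort T]
    refine Finset.sum_congr rfl fun z _ => ?_
    change c z * φ (z : PSpace n).rep * (z : PSpace n).rep k =
      MvPolynomial.eval (z : PSpace n).rep F * f (Pi.single z 1)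
    rw [heval, hc]
    ring
  · by_contra! h
    refine hf0 (LinearMap.ext fun y => ?_)
    rw [hfsum, LinearMap.zero_apply]
    refine Finset.sum_eq_zero fun z _ => ?_
    rw [← hc z, h z z.2, mul_zero]

theorem rep_ne_smul_rep {a p : PSpace n} (h : a ≠ p) (k : ℂ) : a.rep ≠ k • p.rep := by
  intro hk
  apply h
  rw [← a.mk_rep, ← p.mk_rep, Projectivization.mk_eq_mk_iff']
  exact ⟨k, hk.symm⟩

/-- Castelnuovo's lemma, in terms of relations between squares. -/
theorem exists_isRationalNormalCurve (hn : 1 ≤ n) {Z : Finset (PSpace n)}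
    (hZ : InGeneralPosition ℂ (Projectivization.rep : PSpace n → Fin (n + 1) → ℂ) (n + 1) Z)
    (hcard : 2 * n + 3 ≤ Z.card)
    (hrel : ∀ T ⊆ Z, T.card = 2 * n + 2 → ∃ c : PSpace n → ℂ,
      IsSquareRelation Projectivization.rep T c ∧ ∃ z ∈ T, c z ≠ 0) :
    ∃ Γ : Set (PSpace n), IsRationalNormalCurve Γ ∧ (Z : Set (PSpace n)) ⊆ Γ := by
  classical
  have hV : Module.finrank ℂ (Fin (n + 1) → ℂ) = n + 1 := by simp
  obtain ⟨E, hE, hEcard⟩ := Finset.exists_subset_card_eq (s := Z) (n := n + 1) (by omega)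
  obtain ⟨a, haZE, b, hbZE, hab⟩ := Finset.one_lt_card.1 (show 1 < (Z \ E).card by
    rw [Finset.card_sdiff_of_subset hE]; omega)
  obtain ⟨ha, haE⟩ := Finset.mem_sdiff.1 haZE
  obtain ⟨hb, hbE⟩ := Finset.mem_sdiff.1 hbZE
  have hind := hZ E hE hEcard
  have hx : ∀ e : PSpace n, ∃ x : Module.Dual ℂ (Fin (n + 1) → ℂ), e ∈ E →
      x e.rep = 1 ∧ ∀ e' ∈ E, e' ≠ e → x e'.rep = 0 := by
    intro e
    by_cases he : e ∈ E
    · obtain ⟨x, h1, h2⟩ := hind.exists_dual_eq_one (a := e) (by simpa using he)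
      exact ⟨x, fun _ => ⟨h1, fun e' he' => h2 e' (by simpa using he')⟩⟩
    · exact ⟨0, fun h => absurd h he⟩
  choose x hx using hx
  have hx1 : ∀ e ∈ E, x e e.rep = 1 := fun e he => (hx e he).1
  have hx0 : ∀ e ∈ E, ∀ e' ∈ E, e' ≠ e → x e e'.rep = 0 := fun e he => (hx e he).2
  have hxne : ∀ z ∈ Z, z ∉ E → ∀ e ∈ E, x e z.rep ≠ 0 := by
    intro z hz hzE e he
    refine hZ.dual_ne_zero hV (S := E.erase e) ((Finset.erase_subset _ _).trans hE)
      (by rw [Finset.card_erase_of_mem he]; omega) (fun h => ?_) (fun s hs => ?_) hz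
      (fun h => hzE (Finset.mem_of_mem_erase h))
    · have := hx1 e he
      simp [h] at this
    · rw [Finset.mem_erase] at hs
      exact hx0 e he s hs.2 hs.1
  -- The `e`-th coordinate of the curve is the inverse of `w 0 / x e a.rep + w 1 / x e b.rep`,
  -- multiplied by the product over all `j ∈ E` of `w 0 * x j b.rep + w 1 * x j a.rep`.
  obtain ⟨g, hg⟩ := exists_linearEquiv_veroneseVec hind hEcard
    (α := fun e => x e b.rep) (β := fun e => x e a.rep) (γ := fun e => x e a.rep * x e b.rep)
    (fun e he => mul_ne_zero (hxne a ha haE e he) (hxne b hb hbE e he))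
    (fun e he j hj hej => hZ.coordinates_mul_ne hV hE hEcard hx1 hx0 ha hb haE hbE hab
      (hxne a ha haE) he hj hej)
  refine ⟨_, ⟨g, rfl⟩, fun z hz => ?_⟩
  have hz : z ∈ Z := hz
  by_cases hzE : z ∈ E
  · refine mem_range_map_veroneseMap g (w := ![x z a.rep, -x z b.rep])
      -- A basis point is reached where its own linear factor vanishes.
      (k := x z a.rep * x z b.rep *
        ∏ j ∈ E.erase z, (x z a.rep * x j b.rep + -x z b.rep * x j a.rep)) (fun h => ?_) ?_
    · exact hxne a ha haE z hzE (by simpa using congrFun h 0)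
    · rw [hg, Finset.sum_eq_single_of_mem z hzE]
      · simp
      · intro e he hez
        rw [Finset.prod_eq_zero (i := z), mul_zero, zero_smul]
        · simp [hzE, hez.symm]
        · simp only [Matrix.cons_val_zero, Matrix.cons_val_one]; ring
  · obtain ⟨p, q, hpq⟩ : ∃ p q : ℂ, ∀ e ∈ E, x e a.rep * x e b.rep =
        x e z.rep * (p * x e b.rep + q * x e a.rep) := by
      by_cases hza : z = a
      · subst hza
        exact ⟨1, 0, fun e _ => by ring⟩
      by_cases hzb : z = b
      · subst hzb
        exact ⟨0, 1, fun e _ => by ring⟩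
      exact hZ.exists_inverse_coordinates hV hn hcard hrel hE hEcard hx1 hx0 ha hb hz haE hbE hzE
        hab (Ne.symm hza) (Ne.symm hzb)
    refine mem_range_map_veroneseMap g (w := ![p, q])
      (k := ∏ j ∈ E, (p * x j b.rep + q * x j a.rep)) (fun h => ?_) ?_
    · obtain ⟨e, he⟩ : E.Nonempty := Finset.card_pos.1 (by omega)
      have hp : p = 0 := by simpa using congrFun h 0
      have hq : q = 0 := by simpa using congrFun h 1
      have := hpq e he
      simp [hp, hq, hxne a ha haE e he, hxne b hb hbE e he] at this
    · conv_rhs => rw [hind.eq_sum_dual (by rw [hEcard, hV]) hx1 hx0 z.rep, Finset.smul_sum]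
      rw [hg]
      refine Finset.sum_congr rfl fun e he => ?_
      rw [smul_smul, ← Finset.mul_prod_erase E _ he, hpq e he]
      simp only [Matrix.cons_val_zero, Matrix.cons_val_one]
      congr 1
      ring

end Projective

theorem mainTheorem4 (n : ℕ) (Z : Finset (PSpace n))
    (hcard : 2 * n + 3 ≤ Z.card)
    (hquad : hilbertFunction Z 2 ≤ 2 * n + 1)
    (hA : ∃ A : Finset (PSpace n), A ⊆ Z ∧ A.card = 2 * n + 1 ∧ IsLGP A) :
    IsLGP Z ∧ ∃ Γ : Set (PSpace n), IsRationalNormalCurve Γ ∧ (Z : Set (PSpace n)) ⊆ Γ := by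
  classical
  obtain ⟨A, hAZ, hAcard, hA⟩ := hA
  have hV : Module.finrank ℂ (Fin (n + 1) → ℂ) = n + 1 := by simp
  have hrel : ∀ T ⊆ Z, T.card = 2 * n + 2 → ∃ c : PSpace n → ℂ,
      IsSquareRelation Projectivization.rep T c ∧ ∃ z ∈ T, c z ≠ 0 :=
    fun T hT hTcard => exists_isSquareRelation hT (by omega)
  have hZ := InGeneralPosition.of_subset hV (fun a p h => rep_ne_smul_rep h)
    Projectivization.rep_nonzero hrel hAZ ((isLGP_iff (by omega)).1 hA) hAcard
  refine ⟨(isLGP_iff (by omega)).2 hZ, ?_⟩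
  -- For `n = 0` the space is a single point, which cannot contain three.
  rcases Nat.eq_zero_or_pos n with rfl | hn
  · obtain ⟨a, -, b, -, hab⟩ := Finset.one_lt_card.1 (show 1 < Z.card by omega)
    obtain ⟨k, hk⟩ := exists_smul_eq_of_finrank_eq_one hV b.rep_nonzero a.rep
    exact absurd hk.symm (rep_ne_smul_rep hab k)
  · exact exists_isRationalNormalCurve hn hZ hcard hrel
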